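/- Let $k$ and $L$ be fields and let $A$ be a bicommutative (commutative and cocommutative) Hopf algebra over $k$. The set $\mathrm{End}(A)$ of Hopf endomorphisms is a unital ring, with convolution $f*g=\nabla\circ(f\otimes g)\circ\Delta$ as addition and composition as multiplication. Let $\alpha\colon L\to\mathrm{End}(A)$ be an $L$-action on $A$, i.e. a homomorphism of unital rings. Let $\mathrm{Hopf}_k^{\mathrm{bicom}}$ be the category of bicommutative Hopf algebras over $k$ and $\mathrm{Vec}_L^{\mathrm{fin}}$ the category of finite-dimensional $L$-vector spaces. For an abelian category $\mathcal A$, an $\mathcal A$-valued homology theory $F_\bullet$ consists of functors $F_q$ ($q\in\mathbb Z$) from pairs $(K,K')$ of finite CW-spaces to $\mathcal A$ and natural transformations $\partial_q\colon F_{q+1}(K,K')\to F_q(K'):=F_q(K',\emptyset)$, such that the $F_q$ are homotopy invariant, $F_q(K,K\cap K_1)\to F_q(K\cup K_1,K_1)$ is an isomorphism for every triple $(X,K,K_1)$ of a finite CW complex with two subcomplexes, and the long sequence $\cdots\to F_{q+1}(K,K')\to F_q(K')\to F_q(K)\to F_q(K,K')\to\cdots$ is exact for every pair. It is ordinary if $F_q(\mathrm{pt})$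 is a zero object for all $q\neq 0$. Theorem. The pair $(A,\alpha)$ induces an additive functor $(A,\alpha)^{(-)}\colon \mathrm{Vec}_L^{\mathrm{fin}}\to\mathrm{Hopf}_k^{\mathrm{bicom}}$, which sends a linear map to the Hopf map given, with respect to chosen bases, by its matrix acting through $\alpha$. It has the following properties. 1. The functor is exponential: for all $V,W$ the map $(A,\alpha)^V\otimes(A,\alpha)^W\to(A,\alpha)^{V\oplus W}$, $x\otimes y\mapsto (A,\alpha)^{\mathrm{in}_1}(x)\cdot(A,\alpha)^{\mathrm{in}_2}(y)$, is bijective. There is an isomorphism $e\colon(A,\alpha)^L\cong A$ under which multiplication by $c\in L$ corresponds to $\alpha(c)$, and for every $n\ge 0$ an isomorphism $(A,\alpha)^{L^n}\cong A^{\otimes n}$ compatible, via $e$, with the $n$ coordinate projections. Up to natural isomorphism (compatible with the identifications of the values at $L$ with $A$), it is the only additive functor $\mathrm{Vec}_L^{\mathrm{fin}}\to\mathrm{Hopf}_k^{\mathrm{bicom}}$ whose value at $L$ is isomorphic to $A$ with the action $\alpha$. 2. The functor is exact. 3. For every $\mathrm{Vec}_L^{\mathrm{fin}}$-valued homology theory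 $F_\bullet$, composition with $(A,\alpha)^{(-)}$ gives a $\mathrm{Hopf}_k^{\mathrm{bicom}}$-valued homology theory $(A,\alpha)^{F_\bullet}$. 4. If $\dim_k A>1$, then $(A,\alpha)^{F_\bullet}$ is ordinary if and only if $F_\bullet$ is ordinary. -/

import Mathlib

open CategoryTheory CategoryTheory.Limits
open scoped TensorProduct

universe u v w

noncomputable section

/-- Bicommutative (commutative and cocommutative) Hopf algebras over a field `k`. -/
structure HopfBicom (k : Type u) [Field k] where
  /-- The underlying Hopf algebra. -/
  X : Type u
  [commRing : CommRing X]
  [hopfAlgebra : HopfAlgebra k X]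
  [isCocomm : Coalgebra.IsCocomm k X]

namespace HopfBicom

attribute [instance] commRing hopfAlgebra isCocomm

variable {k : Type u} [Field k]

/-- Morphisms are Hopf algebra maps, that is, bialgebra maps (these commute with the antipodes, see
`HopfBicom.map_antipode`). -/
@[ext]
structure Hom (A B : HopfBicom k) where
  /-- The underlying bialgebra map. -/
  hom : A.X →ₐc[k] B.X

instance : Category (HopfBicom k) where
  Hom A B := Hom A B
  id A := ⟨BialgHom.id k A.X⟩
  comp f g := ⟨g.hom.comp f.hom⟩

@[ext]
theorem hom_ext {A B : HopfBicom k} {f g : A ⟶ B} (h : ∀ x : A.X, f.hom x = g.hom x) : f = g :=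
  Hom.ext (DFunLike.ext _ _ h)

@[simp]
theorem id_hom_apply (A : HopfBicom k) (x : A.X) : (𝟙 A : A ⟶ A).hom x = x := rfl

@[simp]
theorem comp_hom_apply {A B C : HopfBicom k} (f : A ⟶ B) (g : B ⟶ C) (x : A.X) :
    (f ≫ g).hom x = g.hom (f.hom x) := rfl

/-- Bialgebra maps of Hopf algebras commute with the antipodes. -/
theorem map_antipode {A B : Type u} [CommRing A] [CommRing B] [HopfAlgebra k A] [HopfAlgebra k B]
    [Coalgebra.IsCocomm k A] (f : A →ₐc[k] B) (x : A) :
    f (HopfAlgebra.antipode k x) = HopfAlgebra.antipode k (f x) := by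
  have h : WithConv.toConv ((f : A →ₐ[k] B).comp (HopfAlgebra.antipodeAlgHom k A)) =
      WithConv.toConv ((HopfAlgebra.antipodeAlgHom k B).comp (f : A →ₐ[k] B)) := by
    have h1 : WithConv.toConv ((f : A →ₐ[k] B).comp (HopfAlgebra.antipodeAlgHom k A)) *
        WithConv.toConv (f : A →ₐ[k] B) = 1 := by
      have := congrArg (fun g => WithConv.toConv ((f : A →ₐ[k] B).comp (WithConv.ofConv g)))
        (AlgHom.antipode_id_cancel (R := k) (A := A))
      simp only [AlgHom.comp_convMul_distrib] at this
      refine Eq.trans ?_ (this.trans ?_)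
      · simp
      · ext x; simp [AlgHom.convOne_def, AlgHomClass.commutes]
    have h2 : WithConv.toConv ((HopfAlgebra.antipodeAlgHom k B).comp (f : A →ₐ[k] B)) *
        WithConv.toConv (f : A →ₐ[k] B) = 1 := by
      have := congrArg (fun g => WithConv.toConv ((WithConv.ofConv g).comp (f : A →ₐ[k] B)))
        (AlgHom.antipode_id_cancel (R := k) (A := B))
      simp only [AlgHom.convMul_comp_bialgHom_distrib] at this
      refine Eq.trans ?_ (this.trans ?_)
      · simp
      · ext x; simp [AlgHom.convOne_def]
    exact (left_inv_eq_right_inv h2 ((mul_comm _ _).trans h1)).symm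
  exact DFunLike.congr_fun (WithConv.toConv_injective h) x


/-- The antipode of a cocommutative commutative Hopf algebra, as a bialgebra map. -/
def antipodeHom (A : Type u) [CommRing A] [HopfAlgebra k A] [Coalgebra.IsCocomm k A] :
    A →ₐc[k] A :=
  BialgHom.ofAlgHom (HopfAlgebra.antipodeAlgHom k A) (AlgHom.counitAlgHom_comp_antipodeAlgHom) <| by
    ext x
    have := map_antipode (Bialgebra.comulBialgHom k A) x
    exact this.symm

/-- The zero morphism `η ∘ ε`. -/
instance (A B : HopfBicom k) : Zero (A ⟶ B) :=
  ⟨⟨(Bialgebra.unitBialgHom k B.X).comp (Bialgebra.counitBialgHom k A.X)⟩⟩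

/-- The sum of two Hopf maps is their convolution `f ∗ g = ∇ ∘ (f ⊗ g) ∘ Δ`. -/
instance (A B : HopfBicom k) : Add (A ⟶ B) :=
  ⟨fun f g => ⟨(Bialgebra.mulBialgHom k B.X).comp
    ((Bialgebra.TensorProduct.map f.hom g.hom).comp (Bialgebra.comulBialgHom k A.X))⟩⟩

/-- The convolution inverse `f ∘ S`. -/
instance (A B : HopfBicom k) : Neg (A ⟶ B) :=
  ⟨fun f => ⟨f.hom.comp (antipodeHom A.X)⟩⟩

theorem zero_hom_apply {A B : HopfBicom k} (x : A.X) :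
    (0 : A ⟶ B).hom x = algebraMap k B.X (Coalgebra.counit x) := rfl

theorem add_hom {A B : HopfBicom k} (f g : A ⟶ B) :
    WithConv.toConv (f + g).hom = WithConv.toConv f.hom * WithConv.toConv g.hom := rfl

theorem add_hom_apply {A B : HopfBicom k} (f g : A ⟶ B) (x : A.X) :
    (f + g).hom x = LinearMap.mul' k B.X
      (TensorProduct.map (f.hom : A.X →ₗ[k] B.X) (g.hom : A.X →ₗ[k] B.X) (Coalgebra.comul x)) := rfl

theorem toConv_injective {A B : HopfBicom k} :
    Function.Injective (fun f : A ⟶ B => WithConv.toConv f.hom) := fun _ _ h =>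
  Hom.ext (WithConv.toConv_injective h)

instance (A B : HopfBicom k) : AddCommGroup (A ⟶ B) where
  add_assoc f g h := toConv_injective (by simp only [add_hom, mul_assoc])
  zero_add f := toConv_injective (one_mul (WithConv.toConv f.hom))
  add_zero f := toConv_injective (mul_one (WithConv.toConv f.hom))
  add_comm f g := toConv_injective (by simp only [add_hom, mul_comm])
  neg_add_cancel f := by
    have := inv_mul_cancel (WithConv.toConv (f.hom : A.X →ₐ[k] B.X))
    ext x
    exact DFunLike.congr_fun (WithConv.toConv_injective this) x
  nsmul := nsmulRec
  zsmul := zsmulRec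

/-- Under convolution, the bicommutative Hopf algebras form a preadditive category. In particular
`End A` is a ring, with convolution as addition and composition as multiplication. -/
instance : Preadditive (HopfBicom k) where
  add_comp A B C f g h := by
    ext x
    simp only [add_hom_apply, comp_hom_apply]
    induction Coalgebra.comul (R := k) x using TensorProduct.induction_on with
    | zero => simp
    | tmul a b => simp
    | add a b ha hb => simp only [map_add, ha, hb]
  comp_add A B C f g h := by
    ext x
    simp only [add_hom_apply, comp_hom_apply, ← CoalgHomClass.map_comp_comul_apply]
    induction Coalgebra.comul (R := k) x using TensorProduct.induction_on with
    | zero => simp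
    | tmul a b => simp
    | add a b ha hb => simp only [map_add, ha, hb]

/-- The ground field as a Hopf algebra. -/
def unit (k : Type u) [Field k] : HopfBicom k := ⟨k⟩

/-- The tensor product of two bicommutative Hopf algebras. -/
def tensor (A B : HopfBicom k) : HopfBicom k := ⟨A.X ⊗[k] B.X⟩

/-- The Hopf map `a ↦ a ⊗ 1`. -/
def inl (A B : HopfBicom k) : A ⟶ tensor A B :=
  ⟨(Bialgebra.TensorProduct.map (BialgHom.id k A.X) (Bialgebra.unitBialgHom k B.X)).comp
    (Bialgebra.TensorProduct.rid k k A.X).symm⟩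

/-- The Hopf map `b ↦ 1 ⊗ b`. -/
def inr (A B : HopfBicom k) : B ⟶ tensor A B :=
  ⟨(Bialgebra.TensorProduct.map (Bialgebra.unitBialgHom k A.X) (BialgHom.id k B.X)).comp
    (Bialgebra.TensorProduct.lid k B.X).symm⟩

/-- The Hopf map `a ⊗ b ↦ ε(b) a`. -/
def fst (A B : HopfBicom k) : tensor A B ⟶ A :=
  ⟨((Bialgebra.TensorProduct.rid k k A.X : A.X ⊗[k] k →ₐc[k] A.X)).comp
    (Bialgebra.TensorProduct.map (BialgHom.id k A.X) (Bialgebra.counitBialgHom k B.X))⟩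

/-- The Hopf map `a ⊗ b ↦ ε(a) b`. -/
def snd (A B : HopfBicom k) : tensor A B ⟶ B :=
  ⟨((Bialgebra.TensorProduct.lid k B.X : k ⊗[k] B.X →ₐc[k] B.X)).comp
    (Bialgebra.TensorProduct.map (Bialgebra.counitBialgHom k A.X) (BialgHom.id k B.X))⟩

theorem inl_hom_apply (A B : HopfBicom k) (a : A.X) : (inl A B).hom a = a ⊗ₜ[k] (1 : B.X) := by
  change a ⊗ₜ[k] (algebraMap k B.X 1) = _
  rw [map_one]

theorem inr_hom_apply (A B : HopfBicom k) (b : B.X) : (inr A B).hom b = (1 : A.X) ⊗ₜ[k] b := by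
  change (algebraMap k A.X 1) ⊗ₜ[k] b = _
  rw [map_one]

theorem fst_hom_tmul (A B : HopfBicom k) (a : A.X) (b : B.X) :
    (fst A B).hom (a ⊗ₜ[k] b : A.X ⊗[k] B.X) = Coalgebra.counit (R := k) b • a := rfl

theorem snd_hom_tmul (A B : HopfBicom k) (a : A.X) (b : B.X) :
    (snd A B).hom (a ⊗ₜ[k] b : A.X ⊗[k] B.X) = Coalgebra.counit (R := k) a • b := rfl

theorem inl_fst (A B : HopfBicom k) : inl A B ≫ fst A B = 𝟙 A := by
  ext a
  rw [comp_hom_apply, inl_hom_apply, fst_hom_tmul]; simp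

theorem inr_snd (A B : HopfBicom k) : inr A B ≫ snd A B = 𝟙 B := by
  ext a
  rw [comp_hom_apply, inr_hom_apply, snd_hom_tmul]; simp

theorem inl_snd (A B : HopfBicom k) : inl A B ≫ snd A B = 0 := by
  ext a
  rw [comp_hom_apply, inl_hom_apply, snd_hom_tmul, zero_hom_apply, Algebra.algebraMap_eq_smul_one]

theorem inr_fst (A B : HopfBicom k) : inr A B ≫ fst A B = 0 := by
  ext a
  rw [comp_hom_apply, inr_hom_apply, fst_hom_tmul, zero_hom_apply, Algebra.algebraMap_eq_smul_one]

theorem tensor_hom_ext {A B C : HopfBicom k} {f g : tensor A B ⟶ C}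
    (h₁ : inl A B ≫ f = inl A B ≫ g) (h₂ : inr A B ≫ f = inr A B ≫ g) : f = g := by
  let f' : A.X ⊗[k] B.X →ₐc[k] C.X := f.hom
  let g' : A.X ⊗[k] B.X →ₐc[k] C.X := g.hom
  have key : (f' : A.X ⊗[k] B.X →ₐ[k] C.X) = (g' : A.X ⊗[k] B.X →ₐ[k] C.X) := by
    apply Algebra.TensorProduct.ext'
    intro a b
    have ha := congrArg (fun t : A ⟶ C => t.hom a) h₁
    have hb := congrArg (fun t : B ⟶ C => t.hom b) h₂
    simp only [comp_hom_apply, inl_hom_apply, inr_hom_apply] at ha hb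
    have hab : a ⊗ₜ[k] b = (a ⊗ₜ[k] (1 : B.X)) * ((1 : A.X) ⊗ₜ[k] b) := by simp
    rw [hab, map_mul, map_mul]
    exact congrArg₂ (· * ·) ha hb
  ext x
  exact DFunLike.congr_fun key x

theorem fst_inl_add_snd_inr (A B : HopfBicom k) :
    fst A B ≫ inl A B + snd A B ≫ inr A B = 𝟙 (tensor A B) := by
  apply tensor_hom_ext
  · rw [Preadditive.comp_add, ← Category.assoc, ← Category.assoc, inl_fst, inl_snd]; simp
  · rw [Preadditive.comp_add, ← Category.assoc, ← Category.assoc, inr_fst, inr_snd]; simp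

/-- The `n`-fold tensor power `A ⊗ ⋯ ⊗ A`. -/
def tpow (A : HopfBicom k) : ℕ → HopfBicom k
  | 0 => unit k
  | n + 1 => tensor A (tpow A n)

/-- The `i`-th projection `a₀ ⊗ ⋯ ⊗ aₙ₋₁ ↦ (∏ j ≠ i, ε(aⱼ)) aᵢ`. -/
def tproj (A : HopfBicom k) : (n : ℕ) → Fin n → (tpow A n ⟶ A)
  | 0 => fun i => i.elim0
  | n + 1 => Fin.cases (fst A (tpow A n)) (fun i => snd A (tpow A n) ≫ tproj A n i)

/-- The `i`-th insertion `a ↦ 1 ⊗ ⋯ ⊗ a ⊗ ⋯ ⊗ 1`. -/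
def tinj (A : HopfBicom k) : (n : ℕ) → Fin n → (A ⟶ tpow A n)
  | 0 => fun i => i.elim0
  | n + 1 => Fin.cases (inl A (tpow A n)) (fun i => tinj A n i ≫ inr A (tpow A n))

theorem tproj_zero (A : HopfBicom k) (n : ℕ) : tproj A (n + 1) 0 = fst A (tpow A n) := rfl

theorem tproj_succ (A : HopfBicom k) (n : ℕ) (i : Fin n) :
    tproj A (n + 1) i.succ = snd A (tpow A n) ≫ tproj A n i := rfl

theorem tinj_zero (A : HopfBicom k) (n : ℕ) : tinj A (n + 1) 0 = inl A (tpow A n) := rfl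

theorem tinj_succ (A : HopfBicom k) (n : ℕ) (i : Fin n) :
    tinj A (n + 1) i.succ = tinj A n i ≫ inr A (tpow A n) := rfl

theorem tinj_tproj (A : HopfBicom k) (n : ℕ) (i j : Fin n) :
    tinj A n i ≫ tproj A n j = if i = j then 𝟙 A else 0 := by
  induction n with
  | zero => exact i.elim0
  | succ n ih =>
    cases i using Fin.cases with
    | zero =>
      cases j using Fin.cases with
      | zero => exact (inl_fst _ _).trans (if_pos rfl).symm
      | succ j =>
        change inl A (tpow A n) ≫ snd A (tpow A n) ≫ tproj A n j = _
        rw [reassoc_of% inl_snd A (tpow A n), zero_comp, if_neg (Fin.succ_ne_zero j).symm]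
    | succ i =>
      cases j using Fin.cases with
      | zero =>
        change (tinj A n i ≫ inr A (tpow A n)) ≫ fst A (tpow A n) = _
        rw [Category.assoc, inr_fst, comp_zero, if_neg (Fin.succ_ne_zero i)]
      | succ j =>
        change (tinj A n i ≫ inr A (tpow A n)) ≫ snd A (tpow A n) ≫ tproj A n j = _
        rw [Category.assoc, reassoc_of% inr_snd A (tpow A n), ih]
        simp only [Fin.succ_inj]

theorem sum_tproj_tinj (A : HopfBicom k) (n : ℕ) :
    ∑ i, tproj A n i ≫ tinj A n i = 𝟙 (tpow A n) := by
  induction n with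
  | zero =>
    ext x
    exact (zero_hom_apply x)
  | succ n ih =>
    rw [Fin.sum_univ_succ]
    have : ∑ i : Fin n, tproj A (n + 1) i.succ ≫ tinj A (n + 1) i.succ =
        snd A (tpow A n) ≫ (∑ i, tproj A n i ≫ tinj A n i) ≫ inr A (tpow A n) := by
      rw [Preadditive.sum_comp, Preadditive.comp_sum]
      refine Finset.sum_congr rfl fun i _ => ?_
      change (snd A (tpow A n) ≫ tproj A n i) ≫ tinj A n i ≫ inr A (tpow A n) = _
      simp only [Category.assoc]
    rw [this, ih, Category.id_comp]
    exact fst_inl_add_snd_inr _ _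

variable {L : Type v} [Field L]

/-- The Hopf map `A^{⊗m} → A^{⊗n}` given by an `n × m` matrix over `L` through the action `α`: its
component from the `i`-th to the `j`-th tensor factor is `α (M j i)`. -/
def actionMatrix (A : HopfBicom k) (α : L →+* End A) {m n : ℕ} (M : Matrix (Fin n) (Fin m) L) :
    tpow A m ⟶ tpow A n :=
  ∑ i, ∑ j, tproj A m i ≫ (α (M j i) : A ⟶ A) ≫ tinj A n j

theorem actionMatrix_one (A : HopfBicom k) (α : L →+* End A) (n : ℕ) :
    actionMatrix A α (1 : Matrix (Fin n) (Fin n) L) = 𝟙 _ := by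
  rw [← sum_tproj_tinj, actionMatrix]
  refine Finset.sum_congr rfl fun i _ => ?_
  rw [Finset.sum_eq_single i]
  · rw [Matrix.one_apply_eq, map_one]
    exact congrArg (tproj A n i ≫ ·) (Category.id_comp _)
  · intro j _ hj
    rw [Matrix.one_apply_ne hj, map_zero]
    simp
  · simp

theorem actionMatrix_mul (A : HopfBicom k) (α : L →+* End A) {l m n : ℕ}
    (N : Matrix (Fin n) (Fin m) L) (M : Matrix (Fin m) (Fin l) L) :
    actionMatrix A α (N * M) = actionMatrix A α M ≫ actionMatrix A α N := by
  have h : ∀ i j p q, (tproj A l i ≫ (α (M j i) : A ⟶ A) ≫ tinj A m j) ≫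
      (tproj A m p ≫ (α (N q p) : A ⟶ A) ≫ tinj A n q) =
      if j = p then tproj A l i ≫ (α (N q p * M j i) : A ⟶ A) ≫ tinj A n q else 0 := by
    intro i j p q
    have h1 : (tproj A l i ≫ (α (M j i) : A ⟶ A) ≫ tinj A m j) ≫
        (tproj A m p ≫ (α (N q p) : A ⟶ A) ≫ tinj A n q) =
        tproj A l i ≫ (α (M j i) : A ⟶ A) ≫ (tinj A m j ≫ tproj A m p) ≫
          (α (N q p) : A ⟶ A) ≫ tinj A n q := by
      simp only [Category.assoc]
    rw [h1, tinj_tproj]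
    split_ifs
    · rw [map_mul, End.mul_def, Category.id_comp, Category.assoc]
    · simp
  have hr : actionMatrix A α M ≫ actionMatrix A α N =
      ∑ i, ∑ j, ∑ q, tproj A l i ≫ (α (N q j * M j i) : A ⟶ A) ≫ tinj A n q := by
    simp only [actionMatrix, Preadditive.sum_comp]
    refine Finset.sum_congr rfl fun i _ => Finset.sum_congr rfl fun j _ => ?_
    rw [Preadditive.comp_sum, Finset.sum_eq_single j]
    · rw [Preadditive.comp_sum]
      refine Finset.sum_congr rfl fun q _ => ?_
      rw [h, if_pos rfl]
    · intro p _ hp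
      rw [Preadditive.comp_sum]
      refine Finset.sum_eq_zero fun q _ => ?_
      rw [h, if_neg (Ne.symm hp)]
    · simp
  rw [hr, actionMatrix]
  refine Finset.sum_congr rfl fun i _ => ?_
  rw [Finset.sum_comm]
  refine Finset.sum_congr rfl fun q _ => ?_
  have hs : (α ((N * M) q i) : A ⟶ A) = ∑ j, (α (N q j * M j i) : A ⟶ A) := by
    rw [Matrix.mul_apply]
    exact map_sum α _ _
  rw [hs, Preadditive.sum_comp, Preadditive.comp_sum]

/-- The functor `(A, α)^(-)` induced by an `L`-action `α : L → End(A)`, a homomorphism of unital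
rings. A vector space `V` with chosen basis of `n` elements is sent to `A^{⊗n}`, a linear map to the
Hopf map given by its matrix. -/
def expFunctor (A : HopfBicom k) (α : L →+* End A) : FGModuleCat.{v} L ⥤ HopfBicom k where
  obj V := tpow A (Module.finrank L V)
  map {V W} f := actionMatrix A α
    (LinearMap.toMatrix (Module.finBasis L V) (Module.finBasis L W) f.hom.hom)
  map_id V := by
    rw [FGModuleCat.hom_hom_id, LinearMap.toMatrix_id, actionMatrix_one]
  map_comp {U V W} f g := by
    rw [FGModuleCat.hom_hom_comp,
      LinearMap.toMatrix_comp (Module.finBasis L U) (Module.finBasis L V) (Module.finBasis L W),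
      actionMatrix_mul]

/-- Multiplication by `c` as an endomorphism of the one-dimensional space `L`. -/
def scalar (c : L) : FGModuleCat.of L L ⟶ FGModuleCat.of L L :=
  FGModuleCat.ofHom (c • LinearMap.id)

/-- The linear map `G(V) ⊗ G(W) → G(V ⊕ W)`, `x ⊗ y ↦ G(inl)(x) · G(inr)(y)`, for a functor `G`
from finite-dimensional vector spaces to bicommutative Hopf algebras. -/
def expMap (G : FGModuleCat.{v} L ⥤ HopfBicom k) (V W : FGModuleCat.{v} L) :
    (G.obj V).X ⊗[k] (G.obj W).X →ₗ[k] (G.obj (FGModuleCat.of L (V × W))).X :=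
  LinearMap.mul' k _ ∘ₗ TensorProduct.map
    ((G.map (FGModuleCat.ofHom (LinearMap.inl L V W) : V ⟶ FGModuleCat.of L (V × W))).hom :
      (G.obj V).X →ₗ[k] (G.obj (FGModuleCat.of L (V × W))).X)
    ((G.map (FGModuleCat.ofHom (LinearMap.inr L V W) : W ⟶ FGModuleCat.of L (V × W))).hom :
      (G.obj W).X →ₗ[k] (G.obj (FGModuleCat.of L (V × W))).X)

end HopfBicom

section CW
open Topology
variable {X : Type w} [TopologicalSpace X] {C : Set X} [CWComplex C]

theorem FinCW.mem_I_of_mem (E : RelCWComplex.Subcomplex C) {n : ℕ} {i : RelCWComplex.cell C n}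
    {x : X} (hx : x ∈ RelCWComplex.openCell n i) (hE : x ∈ (E : Set X)) : i ∈ E.I n := by
  by_contra h
  exact Set.disjoint_left.1
    (CWComplex.Subcomplex.disjoint_openCell_subcomplex_of_not_mem E h) hx hE

theorem FinCW.exists_cell (E : RelCWComplex.Subcomplex C) {x : X} (hE : x ∈ (E : Set X)) :
    ∃ n, ∃ i ∈ E.I n, x ∈ RelCWComplex.openCell (C := C) n i := by
  have h : x ∈ ⋃ (n : ℕ) (j : E.I n), RelCWComplex.openCell (C := C) n j := by
    exact (CWComplex.Subcomplex.union (E := E)).symm ▸ hE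
  simp only [Set.mem_iUnion] at h
  obtain ⟨n, i, hi⟩ := h
  exact ⟨n, i.1, i.2, hi⟩

/-- The intersection of two subcomplexes. -/
def FinCW.inter [T2Space X] (E F : RelCWComplex.Subcomplex C) : RelCWComplex.Subcomplex C where
  carrier := (E : Set X) ∩ F
  I n := E.I n ∩ F.I n
  closed' := E.closed'.inter F.closed'
  union' := by
    rw [Set.empty_union]
    ext x
    simp only [Set.mem_iUnion, Set.mem_inter_iff]
    constructor
    · rintro ⟨n, ⟨i, hE, hF⟩, hx⟩
      exact ⟨CWComplex.Subcomplex.openCell_subset_of_mem E hE hx,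
        CWComplex.Subcomplex.openCell_subset_of_mem F hF hx⟩
    · rintro ⟨hE, hF⟩
      obtain ⟨n, i, hi, hx⟩ := FinCW.exists_cell E hE
      exact ⟨n, ⟨i, hi, FinCW.mem_I_of_mem F hx hF⟩, hx⟩

/-- The union of two subcomplexes. -/
def FinCW.union [T2Space X] (E F : RelCWComplex.Subcomplex C) : RelCWComplex.Subcomplex C where
  carrier := (E : Set X) ∪ F
  I n := E.I n ∪ F.I n
  closed' := E.closed'.union F.closed'
  union' := by
    rw [Set.empty_union]
    ext x
    simp only [Set.mem_iUnion, Set.mem_union]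
    constructor
    · rintro ⟨n, ⟨i, hE | hF⟩, hx⟩
      · exact Or.inl (CWComplex.Subcomplex.openCell_subset_of_mem E hE hx)
      · exact Or.inr (CWComplex.Subcomplex.openCell_subset_of_mem F hF hx)
    · rintro (hE | hF)
      · obtain ⟨n, i, hi, hx⟩ := FinCW.exists_cell E hE
        exact ⟨n, ⟨i, Or.inl hi⟩, hx⟩
      · obtain ⟨n, i, hi, hx⟩ := FinCW.exists_cell F hF
        exact ⟨n, ⟨i, Or.inr hi⟩, hx⟩

/-- The empty subcomplex. -/
def FinCW.empty (C : Set X) [CWComplex C] : RelCWComplex.Subcomplex C where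
  carrier := ∅
  I _ := ∅
  closed' := isClosed_empty
  union' := by simp

/-- `(K, K₀)` is a pair of finite CW-spaces: for some structure of a finite CW complex on `K`, the
set `K₀` is a subcomplex. -/
def IsFiniteCWPair {X : Type w} [TopologicalSpace X] (K K₀ : Set X) : Prop :=
  ∃ (_ : CWComplex K), RelCWComplex.Finite K ∧ ∃ E : RelCWComplex.Subcomplex K, (E : Set X) = K₀

/-- `(X, K, L)` is a triple of finite CW-spaces: for some structure of a finite CW complex on `X`,
both `K` and `L` are subcomplexes. -/
def IsFiniteCWTriple {X : Type w} [TopologicalSpace X] (K L : Set X) : Prop :=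
  ∃ (_ : CWComplex (Set.univ : Set X)), RelCWComplex.Finite (Set.univ : Set X) ∧
    (∃ E : RelCWComplex.Subcomplex (Set.univ : Set X), (E : Set X) = K) ∧
    ∃ F : RelCWComplex.Subcomplex (Set.univ : Set X), (F : Set X) = L

theorem isFiniteCWPair_of_le [T2Space X] [RelCWComplex.Finite C] (E F : RelCWComplex.Subcomplex C)
    (h : (E : Set X) ⊆ F) : IsFiniteCWPair (F : Set X) E := by
  refine ⟨inferInstance, inferInstance, ⟨⟨(E : Set X), fun n => {i | i.1 ∈ E.I n}, E.closed', ?_⟩,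
    rfl⟩⟩
  rw [Set.empty_union]
  ext x
  simp only [Set.mem_iUnion]
  constructor
  · rintro ⟨n, ⟨i, hE⟩, hx⟩
    exact CWComplex.Subcomplex.openCell_subset_of_mem E hE hx
  · intro hx
    obtain ⟨n, i, hi, hxi⟩ := FinCW.exists_cell E hx
    exact ⟨n, ⟨⟨i, FinCW.mem_I_of_mem F hxi (h hx)⟩, hi⟩, hxi⟩

end CW

namespace IsFiniteCWPair
open Topology
variable {X : Type w} [TopologicalSpace X] {K K₀ L : Set X}

theorem absolute (h : IsFiniteCWPair K K₀) : IsFiniteCWPair K ∅ := by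
  obtain ⟨_, hf, -⟩ := h
  exact ⟨inferInstance, hf, FinCW.empty K, rfl⟩

theorem sub [T2Space X] (h : IsFiniteCWPair K K₀) : IsFiniteCWPair K₀ ∅ := by
  obtain ⟨_, hf, E, rfl⟩ := h
  exact isFiniteCWPair_of_le (FinCW.empty K) E (Set.empty_subset _)

theorem subset (h : IsFiniteCWPair K K₀) : K₀ ⊆ K := by
  obtain ⟨_, hf, E, rfl⟩ := h
  exact CWComplex.Subcomplex.subset_complex E

theorem excise [T2Space X] (h : IsFiniteCWTriple K L) : IsFiniteCWPair K (K ∩ L) := by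
  obtain ⟨_, hf, ⟨E, rfl⟩, ⟨F, rfl⟩⟩ := h
  exact isFiniteCWPair_of_le (FinCW.inter E F) E Set.inter_subset_left

theorem unite [T2Space X] (h : IsFiniteCWTriple K L) : IsFiniteCWPair (K ∪ L) L := by
  obtain ⟨_, hf, ⟨E, rfl⟩, ⟨F, rfl⟩⟩ := h
  exact isFiniteCWPair_of_le F (FinCW.union E F) Set.subset_union_right

theorem point : IsFiniteCWPair (Set.univ : Set PUnit.{w + 1}) ∅ := by
  let _ : CWComplex (Set.univ : Set PUnit.{w + 1}) :=
    CWComplex.OfDiscreteClosed (Set.subsingleton_univ.isDiscrete) isClosed_univ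
  refine ⟨inferInstance, ?_, FinCW.empty _, rfl⟩
  rw [CWComplex.finite_iff_finite_cells]
  refine Finite.of_injective (β := PUnit.{1}) (fun _ => PUnit.unit) ?_
  rintro ⟨_ | n, x⟩ ⟨_ | m, y⟩ _
  · exact congrArg (Sigma.mk 0)
      (Subsingleton.elim (α := (Set.univ : Set PUnit.{w + 1})) x y)
  · exact PEmpty.elim y
  · exact PEmpty.elim x
  · exact PEmpty.elim x

end IsFiniteCWPair

/-- Pairs `(K, K₀)` of finite CW-spaces, where `K` is realized as a (closed) subspace of a Hausdorff
space `X`. Every finite CW-space `K` occurs with `X = K`; only the spaces `K` and `K₀`, and not the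
ambient space, enter into the morphisms. -/
structure FinCWPair where
  X : Type w
  [top : TopologicalSpace X]
  [t2 : T2Space X]
  K : Set X
  K₀ : Set X
  isCW : IsFiniteCWPair K K₀

namespace FinCWPair

attribute [instance] top t2

/-- Maps of pairs: continuous maps `K → L` that send `K₀` into `L₀`. -/
@[ext]
structure Hom (P Q : FinCWPair.{w}) where
  toMap : C(P.K, Q.K)
  mapsTo : ∀ x : P.K, x.1 ∈ P.K₀ → (toMap x).1 ∈ Q.K₀

instance : Category FinCWPair.{w} where
  Hom P Q := Hom P Q
  id P := ⟨ContinuousMap.id _, fun _ h => h⟩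
  comp f g := ⟨g.toMap.comp f.toMap, fun x h => g.mapsTo _ (f.mapsTo x h)⟩

/-- Homotopy of maps of pairs (through maps of pairs). -/
def Homotopic {P Q : FinCWPair.{w}} (f g : P ⟶ Q) : Prop :=
  ContinuousMap.HomotopicWith f.toMap g.toMap
    (fun h => ∀ x : P.K, x.1 ∈ P.K₀ → (h x).1 ∈ Q.K₀)

/-- The pair `(K, ∅)`. -/
def absolute (P : FinCWPair.{w}) : FinCWPair.{w} := ⟨P.X, P.K, ∅, P.isCW.absolute⟩

/-- The functor `(K, K₀) ↦ (K₀, ∅)`. -/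
def sub : FinCWPair.{w} ⥤ FinCWPair.{w} where
  obj P := ⟨P.X, P.K₀, ∅, P.isCW.sub⟩
  map {P Q} f :=
    { toMap :=
        { toFun := fun x => ⟨(f.toMap ⟨x.1, P.isCW.subset x.2⟩).1, f.mapsTo _ x.2⟩
          continuous_toFun := by fun_prop }
      mapsTo := fun _ h => h.elim }

/-- The inclusion `(K, K₀) → (L, L₀)` of pairs in the same ambient space. -/
def incl {X : Type w} [TopologicalSpace X] [T2Space X] {K K₀ L L₀ : Set X}
    (hK : IsFiniteCWPair K K₀) (hL : IsFiniteCWPair L L₀) (h : K ⊆ L) (h' : K₀ ⊆ L₀) :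
    (⟨X, K, K₀, hK⟩ : FinCWPair.{w}) ⟶ ⟨X, L, L₀, hL⟩ :=
  ⟨⟨Set.inclusion h, continuous_inclusion h⟩, fun _ hx => h' hx⟩

/-- The inclusion `i : (K₀, ∅) → (K, ∅)`. -/
def i (P : FinCWPair.{w}) : sub.obj P ⟶ absolute P :=
  incl P.isCW.sub P.isCW.absolute P.isCW.subset subset_rfl

/-- The inclusion `j : (K, ∅) → (K, K₀)`. -/
def j (P : FinCWPair.{w}) : absolute P ⟶ P :=
  incl P.isCW.absolute P.isCW subset_rfl (Set.empty_subset _)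

/-- The one-point space. -/
def pt : FinCWPair.{w} := ⟨PUnit.{w + 1}, Set.univ, ∅, IsFiniteCWPair.point⟩

end FinCWPair

/-- The data of a homology theory on pairs of finite CW-spaces: functors `E_q` and natural
transformations `∂_q : E_{q+1}(K, K₀) → E_q(K₀)`, for `q ∈ ℤ`. -/
structure HomologyData (C : Type u) [Category.{v} C] where
  H (q : ℤ) : FinCWPair.{w} ⥤ C
  δ (q : ℤ) : H (q + 1) ⟶ FinCWPair.sub ⋙ H q

/-- `X → Y → Z` is exact at `Y`: the composite is zero and the homology at `Y` exists and vanishes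
(in an abelian category: the image of `f` is the kernel of `g`). -/
def IsExactAt {C : Type u} [Category.{v} C] [HasZeroMorphisms C] {X Y Z : C}
    (f : X ⟶ Y) (g : Y ⟶ Z) : Prop :=
  ∃ w : f ≫ g = 0, (ShortComplex.mk f g w).Exact

namespace HomologyData

/-- The axioms of a homology theory: homotopy invariance, excision and the long exact sequence
`⋯ → E_{q+1}(K) → E_{q+1}(K, K₀) → E_q(K₀) → E_q(K) → E_q(K, K₀) → ⋯`. -/
structure IsHomologyTheory {C : Type u} [Category.{v} C] [HasZeroMorphisms C]
    (E : HomologyData.{u, v, w} C) : Prop where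
  homotopy : ∀ (q : ℤ) {P Q : FinCWPair.{w}} (f g : P ⟶ Q), FinCWPair.Homotopic f g →
    (E.H q).map f = (E.H q).map g
  excision : ∀ (q : ℤ) {X : Type w} [TopologicalSpace X] [T2Space X] {K L : Set X}
    (h : IsFiniteCWTriple K L),
    IsIso ((E.H q).map (FinCWPair.incl (IsFiniteCWPair.excise h) (IsFiniteCWPair.unite h)
      Set.subset_union_left Set.inter_subset_right))
  exact_absolute : ∀ (q : ℤ) (P : FinCWPair.{w}),
    IsExactAt ((E.H q).map P.i) ((E.H q).map P.j)
  exact_relative : ∀ (q : ℤ) (P : FinCWPair.{w}),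
    IsExactAt ((E.H (q + 1)).map P.j) ((E.δ q).app P)
  exact_sub : ∀ (q : ℤ) (P : FinCWPair.{w}),
    IsExactAt ((E.δ q).app P) ((E.H q).map P.i)

/-- All coefficients `E_q(pt)` with `q ≠ 0` are zero objects. -/
def IsOrdinary {C : Type u} [Category.{v} C] (E : HomologyData.{u, v, w} C) : Prop :=
  ∀ q : ℤ, q ≠ 0 → IsZero ((E.H q).obj FinCWPair.pt)

/-- Composition of (the data of) a homology theory with a functor. -/
def comp {C D : Type*} [Category* C] [Category* D] (E : HomologyData C) (G : C ⥤ D) :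
    HomologyData D where
  H q := E.H q ⋙ G
  δ q := Functor.whiskerRight (E.δ q) G

end HomologyData

end

/-! Exactness has nothing to do with Hopf algebras. Every linear map f admits g with fgf = f, by
inverting f on its image. Hence its kernel and cokernel are direct summands cut out by idempotents
built from f and g, and splittings of idempotents are equational, so every additive functor
preserves them. Additive functors also preserve biproducts, so any additive functor on
finite-dimensional spaces preserves finite limits and colimits (`preservesFiniteLimits_of_additive`,
`preservesFiniteColimits_of_additive`). That the target category is abelian is never needed. The
axioms of a homology theory consist of equalities, isomorphisms and exact sequences, all of which
such a functor keeps.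

With convolution as addition, the tensor product of bicommutative Hopf algebras is a biproduct, so
an additive functor turns direct sums into tensor products (`prodIso`). A basis of V writes the
identity of V as a sum of maps through L. Applying an additive functor G identifies G(V) with a
tensor power of G(L) (`basisIso`), and naturality only involves how G acts on scalars, that is, the
action (`expFunctorIso`). This gives uniqueness.

For ordinariness, A is a retract of each of its positive tensor powers, and a zero object has
dimension at most one. So if A has dimension greater than one, the functor detects zero spaces
(`isZero_expFunctor_obj_iff`). -/

noncomputable section

/-! ### Von Neumann regular morphisms and additive functors -/

section Splitting

variable {C : Type*} [Category* C] [Preadditive C] {D : Type*} [Category* D] [Preadditive D]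

/-- An additive functor preserves the kernel of a von Neumann regular morphism. -/
theorem preservesKernel_of_regular (F : C ⥤ D) [F.Additive] {X Y : C} (f : X ⟶ Y) (g : Y ⟶ X)
    (h : f ≫ g ≫ f = f) : PreservesLimit (parallelPair f 0) F where
  preserves {c} hc := by
    -- By regularity `𝟙 X - f ≫ g` is an idempotent with image the kernel of `f`. Its factorization
    -- `s` is a retraction of the kernel inclusion, and the two splitting equations survive under
    -- `F`.
    have hw : (𝟙 X - f ≫ g) ≫ f = 0 := by simp [Preadditive.sub_comp, h]
    let s : X ⟶ c.pt := hc.lift (KernelFork.ofι _ hw)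
    have hs : s ≫ Fork.ι c = 𝟙 X - f ≫ g := hc.fac _ WalkingParallelPair.zero
    have hc0 : Fork.ι c ≫ f = 0 := KernelFork.condition c
    have hs' : Fork.ι c ≫ s = 𝟙 _ := by
      refine Fork.IsLimit.hom_ext hc ?_
      rw [Category.assoc, hs, Preadditive.comp_sub, reassoc_of% hc0]
      simp
    have hs1 : F.map s ≫ F.map (Fork.ι c) = 𝟙 _ - F.map f ≫ F.map g := by
      rw [← F.map_comp, hs, F.map_sub, F.map_id, F.map_comp]
    have hs2 : F.map (Fork.ι c) ≫ F.map s = 𝟙 _ := by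
      rw [← F.map_comp, hs', F.map_id]
    refine ⟨(KernelFork.isLimitMapConeEquiv c F).symm (KernelFork.IsLimit.ofι _
      (KernelFork.map_condition c F)
      (fun k _ => k ≫ F.map s) (fun k hk => ?_) (fun k hk m hm => ?_))⟩
    · rw [Category.assoc, hs1, Preadditive.comp_sub, reassoc_of% hk]
      simp
    · rw [← hm, Category.assoc, hs2, Category.comp_id]

/-- An additive functor preserves the cokernel of a von Neumann regular morphism. -/
theorem preservesCokernel_of_regular (F : C ⥤ D) [F.Additive] {X Y : C} (f : X ⟶ Y) (g : Y ⟶ X)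
    (h : f ≫ g ≫ f = f) : PreservesColimit (parallelPair f 0) F where
  preserves {c} hc := by
    -- Dually, `𝟙 Y - g ≫ f` is an idempotent splitting through the cokernel, and `s` is a section
    -- of the cokernel projection.
    have hw : f ≫ (𝟙 Y - g ≫ f) = 0 := by simp [Preadditive.comp_sub, h]
    let s : c.pt ⟶ Y := hc.desc (CokernelCofork.ofπ _ hw)
    have hs : Cofork.π c ≫ s = 𝟙 Y - g ≫ f := hc.fac _ WalkingParallelPair.one
    have hc0 : f ≫ Cofork.π c = 0 := CokernelCofork.condition c
    have hs' : s ≫ Cofork.π c = 𝟙 _ := by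
      refine Cofork.IsColimit.hom_ext hc ?_
      rw [← Category.assoc, hs, Preadditive.sub_comp, Category.assoc, hc0]
      simp
    have hs1 : F.map (Cofork.π c) ≫ F.map s = 𝟙 _ - F.map g ≫ F.map f := by
      rw [← F.map_comp, hs, F.map_sub, F.map_id, F.map_comp]
    have hs2 : F.map s ≫ F.map (Cofork.π c) = 𝟙 _ := by
      rw [← F.map_comp, hs', F.map_id]
    refine ⟨(CokernelCofork.isColimitMapCoconeEquiv c F).symm (CokernelCofork.IsColimit.ofπ _
      (CokernelCofork.map_condition c F)
      (fun k _ => F.map s ≫ k) (fun k hk => ?_) (fun k hk m hm => ?_))⟩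
    · rw [← Category.assoc, hs1, Preadditive.sub_comp, Category.assoc, hk]
      simp
    · rw [← hm, ← Category.assoc, hs2, Category.id_comp]

end Splitting

/-! ### Linear algebra of finite-dimensional spaces in terms of maps through L -/

namespace FGModuleCat

variable {L : Type v} [Field L]

/-- Every linear map `f` of vector spaces is von Neumann regular. -/
theorem exists_regular {V W : FGModuleCat.{v} L} (f : V ⟶ W) : ∃ g : W ⟶ V, f ≫ g ≫ f = f := by
  obtain ⟨r, hr⟩ := f.hom.hom.rangeRestrict.exists_rightInverse_of_surjective
    (LinearMap.range_rangeRestrict _)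
  -- Only the restriction of `g` to the range of `f`, where it is the section `r`, matters; any
  -- linear extension to `W` will do.
  obtain ⟨g, hg⟩ := r.exists_extend
  refine ⟨ofHom g, FGModuleCat.hom_ext (LinearMap.ext fun x => ?_)⟩
  have h1 := LinearMap.congr_fun hg (f.hom.hom.rangeRestrict x)
  have h2 := congrArg Subtype.val (LinearMap.congr_fun hr (f.hom.hom.rangeRestrict x))
  exact (congrArg f.hom.hom h1).trans h2

theorem ofHom_sum {V W : Type v} [AddCommGroup V] [Module L V] [Module.Finite L V]
    [AddCommGroup W] [Module L W] [Module.Finite L W] {ι : Type*} (s : Finset ι)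
    (f : ι → V →ₗ[L] W) : ofHom (∑ i ∈ s, f i) = ∑ i ∈ s, ofHom (f i) :=
  map_sum (AddMonoidHom.mk' (fun f : V →ₗ[L] W => ofHom f) fun _ _ => rfl) f s

/-- The linear map `L → V`, `c ↦ c v`. -/
abbrev point (V : FGModuleCat.{v} L) (v : V) : of L L ⟶ V :=
  ofHom (LinearMap.toSpanSingleton L V v)

/-- The `i`-th coordinate `V → L` with respect to a basis. -/
abbrev coord (V : FGModuleCat.{v} L) {n : ℕ} (b : Module.Basis (Fin n) L V) (i : Fin n) :
    V ⟶ of L L :=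
  ofHom (b.coord i)

/-- Together with `point_coord` this presents V as an n-fold biproduct of L by equations alone, a
form to which any additive functor can be applied. -/
theorem sum_coord_point (V : FGModuleCat.{v} L) {n : ℕ} (b : Module.Basis (Fin n) L V) :
    ∑ i, coord V b i ≫ point V (b i) = 𝟙 V := by
  refine Eq.trans (ofHom_sum Finset.univ
    fun i => LinearMap.toSpanSingleton L V (b i) ∘ₗ b.coord i).symm ?_
  refine FGModuleCat.hom_ext (LinearMap.ext fun x => ?_)
  refine Eq.trans ?_ (b.sum_repr x)
  change (∑ i, LinearMap.toSpanSingleton L V (b i) ∘ₗ b.coord i) x = _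
  simp

theorem point_coord (V : FGModuleCat.{v} L) {n : ℕ} (b : Module.Basis (Fin n) L V) (i j : Fin n) :
    point V (b i) ≫ coord V b j = if i = j then 𝟙 _ else 0 := by
  have h : b.coord j ∘ₗ LinearMap.toSpanSingleton L V (b i) =
      if i = j then LinearMap.id else 0 := by
    ext
    split_ifs with h <;> simp [h, Module.Basis.repr_self]
  refine (congrArg (fun t => ofHom t) h).trans ?_
  split_ifs <;> rfl

/-- The expansion of the image of a basis vector along the matrix column, phrased through scalars on
L. This is where the action enters the naturality of `expFunctorIso`. -/
theorem sum_scalar_point {V W : FGModuleCat.{v} L} {m n : ℕ} (b : Module.Basis (Fin m) L V)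
    (b' : Module.Basis (Fin n) L W) (f : V ⟶ W) (i : Fin m) :
    ∑ j, HopfBicom.scalar (LinearMap.toMatrix b b' f.hom.hom j i) ≫ point W (b' j) =
      point V (b i) ≫ f := by
  refine Eq.trans (ofHom_sum Finset.univ fun j => LinearMap.toSpanSingleton L W (b' j) ∘ₗ
    (LinearMap.toMatrix b b' f.hom.hom j i • LinearMap.id)).symm ?_
  refine FGModuleCat.hom_ext (LinearMap.ext_ring ?_)
  change (∑ j, LinearMap.toSpanSingleton L W (b' j) ∘ₗ
    (LinearMap.toMatrix b b' f.hom.hom j i • LinearMap.id)) 1 = f.hom.hom ((1 : L) • b i)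
  rw [one_smul, ← b'.sum_repr (f.hom.hom (b i))]
  simp [LinearMap.toMatrix_apply]

end FGModuleCat

/-! ### Exactness of additive functors and transport of homology theories -/

/-- Additive functors on finite-dimensional vector spaces preserve finite limits. -/
theorem preservesFiniteLimits_of_additive {L : Type v} [Field L] {D : Type*} [Category* D]
    [Preadditive D] [HasZeroObject D] (F : FGModuleCat.{v} L ⥤ D) [F.Additive] :
    PreservesFiniteLimits F := by
  have (X Y : FGModuleCat.{v} L) (f : X ⟶ Y) : PreservesLimit (parallelPair f 0) F :=
    let ⟨g, hg⟩ := FGModuleCat.exists_regular f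
    preservesKernel_of_regular F f g hg
  -- Kernels suffice: finite biproducts are preserved by additivity, and an equalizer is the kernel
  -- of a difference.
  exact F.preservesFiniteLimits_of_preservesKernels

/-- Additive functors on finite-dimensional vector spaces preserve finite colimits. -/
theorem preservesFiniteColimits_of_additive {L : Type v} [Field L] {D : Type*} [Category* D]
    [Preadditive D] [HasZeroObject D] (F : FGModuleCat.{v} L ⥤ D) [F.Additive] :
    PreservesFiniteColimits F := by
  have (X Y : FGModuleCat.{v} L) (f : X ⟶ Y) : PreservesColimit (parallelPair f 0) F :=
    let ⟨g, hg⟩ := FGModuleCat.exists_regular f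
    preservesCokernel_of_regular F f g hg
  exact F.preservesFiniteColimits_of_preservesCokernels

/-- Exactness includes the existence of homology. The functor carries the data exhibiting it to the
target, which therefore need not have all kernels and cokernels. -/
theorem IsExactAt.map {C : Type*} [Category* C] [HasZeroMorphisms C] {D : Type*} [Category* D]
    [HasZeroMorphisms D] (F : C ⥤ D) [F.PreservesZeroMorphisms] [PreservesFiniteLimits F]
    [PreservesFiniteColimits F] {X Y Z : C} {f : X ⟶ Y} {g : Y ⟶ Z} (h : IsExactAt f g) :
    IsExactAt (F.map f) (F.map g) := by
  obtain ⟨w, h⟩ := h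
  exact ⟨by rw [← F.map_comp, w, F.map_zero], h.map F⟩

/-- Exact functors preserve homology theories. -/
theorem HomologyData.IsHomologyTheory.comp {C : Type*} [Category* C] [HasZeroMorphisms C]
    {D : Type*} [Category* D] [HasZeroMorphisms D] {E : HomologyData C} (h : E.IsHomologyTheory)
    (F : C ⥤ D) [F.PreservesZeroMorphisms] [PreservesFiniteLimits F] [PreservesFiniteColimits F] :
    (E.comp F).IsHomologyTheory where
  homotopy q _ _ f g hfg := congrArg F.map (h.homotopy q f g hfg)
  excision q _ _ _ _ _ ht :=
    have := h.excision q ht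
    Functor.map_isIso F _
  exact_absolute q P := (h.exact_absolute q P).map F
  exact_relative q P := (h.exact_relative q P).map F
  exact_sub q P := (h.exact_sub q P).map F

/-! ### Zero objects, additivity and tensor products of Hopf algebras -/

namespace HopfBicom

variable {k : Type u} [Field k] {L : Type v} [Field L]

/-- For n = 0 the decomposition of the identity is an empty sum. -/
theorem isZero_tpow_zero (A : HopfBicom k) : IsZero (tpow A 0) :=
  (IsZero.iff_id_eq_zero _).2 (sum_tproj_tinj A 0).symm

instance : HasZeroObject (HopfBicom k) := ⟨_, isZero_tpow_zero (unit k)⟩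

/-- If the identity equals the zero morphism, then x = ε(x)1 for every x, so 1 spans. -/
theorem rank_le_one_of_isZero {A : HopfBicom k} (h : IsZero A) : Module.rank k A.X ≤ 1 := by
  rw [rank_le_one_iff]
  refine ⟨1, fun x => ⟨Coalgebra.counit x, ?_⟩⟩
  rw [← Algebra.algebraMap_eq_smul_one, ← zero_hom_apply (A := A) (B := A), ← h.eq_of_src (𝟙 A) 0,
    id_hom_apply]

theorem eq_zero_of_isZero_tpow {A : HopfBicom k} (hA : 1 < Module.rank k A.X) {n : ℕ}
    (h : IsZero (tpow A n)) : n = 0 := by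
  cases n with
  | zero => rfl
  | succ n =>
    -- `A` is a retract of its (n+1)-st tensor power through `inl` and `fst`, so it would itself be
    -- zero.
    refine absurd (rank_le_one_of_isZero ((IsZero.iff_id_eq_zero A).2 ?_)) hA.not_ge
    rw [← inl_fst A (tpow A n), h.eq_of_tgt (inl A (tpow A n)) 0]
    exact zero_comp

instance (A : HopfBicom k) (α : L →+* End A) : (expFunctor A α).Additive where
  map_add {V W f g} := by
    change actionMatrix A α (LinearMap.toMatrix _ _ (f.hom.hom + g.hom.hom)) =
      actionMatrix A α _ + actionMatrix A α _
    have h (i j) (a b : L) : tproj A (Module.finrank L V) i ≫ (α (a + b) : A ⟶ A) ≫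
        tinj A (Module.finrank L W) j = tproj A _ i ≫ (α a : A ⟶ A) ≫ tinj A _ j +
          tproj A _ i ≫ (α b : A ⟶ A) ≫ tinj A _ j := by
      rw [← Preadditive.comp_add, map_add]
      exact congrArg _ (Preadditive.add_comp _ _ _ _ _ _)
    rw [map_add]
    simp only [actionMatrix, Matrix.add_apply, h, Finset.sum_add_distrib]
    rfl

/-- The Hopf map `A ⊗ B → C` with given restrictions to the two factors. -/
theorem desc_hom_tmul {A B C : HopfBicom k} (f : A ⟶ C) (g : B ⟶ C) (a : A.X) (b : B.X) :
    (fst A B ≫ f + snd A B ≫ g).hom (a ⊗ₜ[k] b : A.X ⊗[k] B.X) = f.hom a * g.hom b := by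
  have hab : (a ⊗ₜ[k] b : A.X ⊗[k] B.X) = (inl A B).hom a * (inr A B).hom b := by
    rw [inl_hom_apply, inr_hom_apply]
    exact (by simp : a ⊗ₜ[k] b = (a ⊗ₜ[k] (1 : B.X)) * ((1 : A.X) ⊗ₜ[k] b))
  have hl : inl A B ≫ (fst A B ≫ f + snd A B ≫ g) = f := by
    rw [Preadditive.comp_add, reassoc_of% inl_fst A B, reassoc_of% inl_snd A B]; simp
  have hr : inr A B ≫ (fst A B ≫ f + snd A B ≫ g) = g := by
    rw [Preadditive.comp_add, reassoc_of% inr_fst A B, reassoc_of% inr_snd A B]; simp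
  have h1 := congrArg (fun t : A ⟶ C => t.hom a) hl
  have h2 := congrArg (fun t : B ⟶ C => t.hom b) hr
  simp only [comp_hom_apply] at h1 h2
  refine (congrArg _ hab).trans ((map_mul (fst A B ≫ f + snd A B ≫ g).hom _ _).trans ?_)
  rw [h1, h2]

theorem hom_bijective {A B : HopfBicom k} (e : A ≅ B) : Function.Bijective e.hom.hom := by
  refine Function.bijective_iff_has_inverse.2 ⟨e.inv.hom, fun x => ?_, fun x => ?_⟩
  · rw [← comp_hom_apply, e.hom_inv_id, id_hom_apply]
  · rw [← comp_hom_apply, e.inv_hom_id, id_hom_apply]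

/-- An additive functor turns direct sums into tensor products. -/
def prodIso (G : FGModuleCat.{v} L ⥤ HopfBicom k) [G.Additive] (V W : FGModuleCat.{v} L) :
    tensor (G.obj V) (G.obj W) ≅ G.obj (FGModuleCat.of L (V × W)) where
  hom := fst _ _ ≫ G.map (FGModuleCat.ofHom (LinearMap.inl L V W) : V ⟶ FGModuleCat.of L (V × W)) +
    snd _ _ ≫ G.map (FGModuleCat.ofHom (LinearMap.inr L V W) : W ⟶ FGModuleCat.of L (V × W))
  inv := G.map (FGModuleCat.ofHom (LinearMap.fst L V W) : FGModuleCat.of L (V × W) ⟶ V) ≫ inl _ _ +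
    G.map (FGModuleCat.ofHom (LinearMap.snd L V W) : FGModuleCat.of L (V × W) ⟶ W) ≫ inr _ _
  hom_inv_id := by
    have h1 : (FGModuleCat.ofHom (LinearMap.inl L V W) : V ⟶ FGModuleCat.of L (V × W)) ≫
        FGModuleCat.ofHom (LinearMap.fst L V W) = 𝟙 V := rfl
    have h2 : (FGModuleCat.ofHom (LinearMap.inl L V W) : V ⟶ FGModuleCat.of L (V × W)) ≫
        (FGModuleCat.ofHom (LinearMap.snd L V W) : FGModuleCat.of L (V × W) ⟶ W) = 0 := rfl
    have h3 : (FGModuleCat.ofHom (LinearMap.inr L V W) : W ⟶ FGModuleCat.of L (V × W)) ≫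
        (FGModuleCat.ofHom (LinearMap.fst L V W) : FGModuleCat.of L (V × W) ⟶ V) = 0 := rfl
    have h4 : (FGModuleCat.ofHom (LinearMap.inr L V W) : W ⟶ FGModuleCat.of L (V × W)) ≫
        FGModuleCat.ofHom (LinearMap.snd L V W) = 𝟙 W := rfl
    simp only [Preadditive.add_comp, Preadditive.comp_add, Category.assoc, ← G.map_comp_assoc,
      h1, h2, h3, h4, G.map_id, G.map_zero, zero_comp, comp_zero, Category.id_comp, zero_add,
      add_zero]
    exact fst_inl_add_snd_inr _ _
  inv_hom_id := by
    have h : (FGModuleCat.ofHom (LinearMap.fst L V W) : FGModuleCat.of L (V × W) ⟶ V) ≫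
          FGModuleCat.ofHom (LinearMap.inl L V W) +
        (FGModuleCat.ofHom (LinearMap.snd L V W) : FGModuleCat.of L (V × W) ⟶ W) ≫
          FGModuleCat.ofHom (LinearMap.inr L V W) = 𝟙 (FGModuleCat.of L (V × W)) := by
      refine FGModuleCat.hom_ext (LinearMap.ext fun x => ?_)
      change ((x.1, (0 : W)) + ((0 : V), x.2) : V × W) = x
      simp
    rw [← G.map_id, ← h, G.map_add, G.map_comp, G.map_comp]
    simp only [Preadditive.add_comp, Preadditive.comp_add, Category.assoc,
      reassoc_of% inl_fst, reassoc_of% inl_snd, reassoc_of% inr_fst, reassoc_of% inr_snd,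
      zero_comp, comp_zero, zero_add, add_zero]

/-- The multiplication map is a priori only linear; it is compared on pure tensors with the Hopf
isomorphism `prodIso`. -/
theorem expMap_bijective (G : FGModuleCat.{v} L ⥤ HopfBicom k) [G.Additive]
    (V W : FGModuleCat.{v} L) : Function.Bijective (expMap G V W) := by
  have h : (expMap G V W : _ → _) = (prodIso G V W).hom.hom := by
    let φ : (G.obj V).X ⊗[k] (G.obj W).X →ₐc[k] (G.obj (FGModuleCat.of L (V × W))).X :=
      (prodIso G V W).hom.hom
    have : expMap G V W = (φ : _ →ₗ[k] _) :=
      TensorProduct.ext' fun a b => (desc_hom_tmul _ _ a b).symm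
    exact congrArg DFunLike.coe this
  rw [h]
  exact hom_bijective _

/-! ### Reconstruction of an additive functor from its value at L -/

/-- Morphisms out of and into a tensor power compose like block vectors. -/
theorem sum_tproj_comp_sum_tinj {A X Y : HopfBicom k} {n : ℕ} (f : Fin n → (X ⟶ A))
    (g : Fin n → (A ⟶ Y)) :
    (∑ i, f i ≫ tinj A n i) ≫ ∑ j, tproj A n j ≫ g j = ∑ i, f i ≫ g i := by
  rw [Preadditive.sum_comp]
  refine Finset.sum_congr rfl fun i _ => ?_
  rw [Preadditive.comp_sum, Finset.sum_eq_single i]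
  · rw [Category.assoc, ← Category.assoc (tinj A n i), tinj_tproj, if_pos rfl, Category.id_comp]
  · intro j _ hj
    rw [Category.assoc, ← Category.assoc (tinj A n i), tinj_tproj, if_neg hj.symm]
    simp
  · simp

theorem sum_tinj_tproj {A X : HopfBicom k} {n : ℕ} (f : Fin n → (X ⟶ A)) (j : Fin n) :
    (∑ i, f i ≫ tinj A n i) ≫ tproj A n j = f j := by
  rw [Preadditive.sum_comp, Finset.sum_eq_single j]
  · rw [Category.assoc, tinj_tproj, if_pos rfl, Category.comp_id]
  · intro i _ hi
    rw [Category.assoc, tinj_tproj, if_neg hi, comp_zero]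
  · simp

/-- The value of an additive functor on a space with a basis of `n` elements is the `n`-fold tensor
power of its value on `L`. -/
def basisIso {A : HopfBicom k} (G : FGModuleCat.{v} L ⥤ HopfBicom k) [G.Additive]
    (e : G.obj (FGModuleCat.of L L) ≅ A) {V : FGModuleCat.{v} L} {n : ℕ}
    (b : Module.Basis (Fin n) L V) : tpow A n ≅ G.obj V where
  hom := ∑ i, tproj A n i ≫ e.inv ≫ G.map (FGModuleCat.point V (b i))
  inv := ∑ i, (G.map (FGModuleCat.coord V b i) ≫ e.hom) ≫ tinj A n i
  hom_inv_id := by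
    have h (i j : Fin n) : (tproj A n i ≫ e.inv ≫ G.map (FGModuleCat.point V (b i))) ≫
        (G.map (FGModuleCat.coord V b j) ≫ e.hom) ≫ tinj A n j =
        if i = j then tproj A n i ≫ tinj A n i else 0 := by
      have h' : G.map (FGModuleCat.point V (b i)) ≫ G.map (FGModuleCat.coord V b j) =
          if i = j then 𝟙 _ else 0 := by
        rw [← G.map_comp, FGModuleCat.point_coord]
        split_ifs
        · exact G.map_id _
        · exact G.map_zero _ _
      simp only [Category.assoc]
      rw [reassoc_of% h']
      split_ifs with hij
      · subst hij; simp
      · simp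
    simp only [Preadditive.sum_comp, Preadditive.comp_sum, h, Finset.sum_ite_eq',
      Finset.mem_univ, if_true]
    exact sum_tproj_tinj A n
  inv_hom_id := by
    rw [sum_tproj_comp_sum_tinj, ← G.map_id, ← FGModuleCat.sum_coord_point V b, G.map_sum]
    exact Finset.sum_congr rfl fun i _ => by simp

/-- An additive functor whose value on `L` is `A` with the action `α` is the functor induced by
`(A, α)`. -/
def expFunctorIso {A : HopfBicom k} {α : L →+* End A} (G : FGModuleCat.{v} L ⥤ HopfBicom k)
    [G.Additive] (e : G.obj (FGModuleCat.of L L) ≅ A)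
    (he : ∀ c : L, G.map (scalar c) ≫ e.hom = e.hom ≫ (α c : A ⟶ A)) : expFunctor A α ≅ G :=
  NatIso.ofComponents (fun V => basisIso G e (Module.finBasis L V)) fun {V W} f => by
    -- The equivariance of `e`, turned around so that matrix entries move past `e.inv` and become
    -- scalars under `G`.
    have he' (c : L) : (α c : A ⟶ A) ≫ e.inv = e.inv ≫ G.map (scalar c) := by
      rw [Iso.eq_inv_comp, ← reassoc_of% he c, e.hom_inv_id, Category.comp_id]
    change actionMatrix A α (LinearMap.toMatrix (Module.finBasis L V) (Module.finBasis L W)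
      f.hom.hom) ≫ (∑ j, tproj A _ j ≫ e.inv ≫ G.map (FGModuleCat.point W _)) =
      (∑ i, tproj A _ i ≫ e.inv ≫ G.map (FGModuleCat.point V _)) ≫ G.map f
    rw [actionMatrix, Preadditive.sum_comp, Preadditive.sum_comp]
    refine Finset.sum_congr rfl fun i _ => ?_
    have := sum_tproj_comp_sum_tinj
      (fun j => tproj A _ i ≫ (α (LinearMap.toMatrix (Module.finBasis L V) (Module.finBasis L W)
        f.hom.hom j i) : A ⟶ A))
      (fun j => e.inv ≫ G.map (FGModuleCat.point W (Module.finBasis L W j)))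
    simp only [Category.assoc] at this
    rw [this, Category.assoc, Category.assoc, ← G.map_comp,
      ← FGModuleCat.sum_scalar_point _ (Module.finBasis L W) f i, G.map_sum, Preadditive.comp_sum,
      Preadditive.comp_sum]
    refine Finset.sum_congr rfl fun j _ => ?_
    rw [reassoc_of% he', G.map_comp]

/-! ### The value at L and its action -/

/-- The Hopf map `A^{⊗n} → A` whose `i`-th component is the action of the `i`-th vector of the
chosen basis of `L`. -/
def evalHom (A : HopfBicom k) (α : L →+* End A) :
    (expFunctor A α).obj (FGModuleCat.of L L) ⟶ A :=
  ∑ i, tproj A _ i ≫ (α (Module.finBasis L (FGModuleCat.of L L) i : L) : A ⟶ A)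

/-- The inverse of `evalHom`, given by the coordinates of `1`. -/
def evalInv (A : HopfBicom k) (α : L →+* End A) :
    A ⟶ (expFunctor A α).obj (FGModuleCat.of L L) :=
  ∑ i, (α ((Module.finBasis L (FGModuleCat.of L L)).repr (1 : L) i) : A ⟶ A) ≫ tinj A _ i

theorem action_comp {A : HopfBicom k} (α : L →+* End A) (c d : L) :
    (α c : A ⟶ A) ≫ (α d : A ⟶ A) = (α (d * c) : A ⟶ A) :=
  (map_mul α d c).symm

theorem action_one {A : HopfBicom k} (α : L →+* End A) : (α 1 : A ⟶ A) = 𝟙 A := map_one α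

/-- The chosen basis of L need not be 1, and the value at L is a tensor power indexed by `finrank L
L`. The composite is α applied to the expansion of 1 in that basis. -/
theorem evalInv_evalHom (A : HopfBicom k) (α : L →+* End A) : evalInv A α ≫ evalHom A α = 𝟙 A := by
  let b : Module.Basis (Fin (Module.finrank L L)) L L := Module.finBasis L L
  have h : ∑ i, b i * b.repr 1 i = 1 := by
    simpa [mul_comm] using b.sum_repr 1
  refine (sum_tproj_comp_sum_tinj _ _).trans ?_
  simp only [action_comp]
  refine (map_sum α (fun i => b i * b.repr 1 i) Finset.univ).symm.trans ?_
  rw [h]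
  exact action_one α

theorem evalHom_evalInv (A : HopfBicom k) (α : L →+* End A) :
    evalHom A α ≫ evalInv A α = 𝟙 _ := by
  let b : Module.Basis (Fin (Module.finrank L L)) L L := Module.finBasis L L
  -- The coordinates of b_i · 1 are b_i times those of 1, so the matrix of the composite is the
  -- identity.
  have h (i j) : b.repr 1 j * b i = (1 : Matrix _ _ L) j i := by
    have := congrArg (fun t => t j) (b.repr.map_smul (b i) 1)
    simp only [smul_eq_mul, mul_one, b.repr_self, Finsupp.smul_apply] at this
    rw [mul_comm, ← this, Finsupp.single_apply, Matrix.one_apply]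
    simp only [eq_comm]
  refine Eq.trans ?_ (actionMatrix_one A α _)
  rw [evalHom, Preadditive.sum_comp, actionMatrix]
  refine Finset.sum_congr rfl fun i _ => ?_
  rw [evalInv, Preadditive.comp_sum]
  refine Finset.sum_congr rfl fun j _ => ?_
  rw [← h, ← action_comp]
  simp only [Category.assoc]
  rfl

/-- The value of the functor `(A, α)^(-)` on `L` is `A`. -/
def evalIso (A : HopfBicom k) (α : L →+* End A) :
    (expFunctor A α).obj (FGModuleCat.of L L) ≅ A where
  hom := evalHom A α
  inv := evalInv A α
  hom_inv_id := evalHom_evalInv A α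
  inv_hom_id := evalInv_evalHom A α

/-- On the i-th factor both sides are α of a scalar: the sum of the b_j M_ji on one side, c b_i on
the other. They agree because the i-th column of M expands c b_i. -/
theorem scalar_evalIso (A : HopfBicom k) (α : L →+* End A) (c : L) :
    (expFunctor A α).map (scalar c) ≫ (evalIso A α).hom = (evalIso A α).hom ≫ (α c : A ⟶ A) := by
  let b := Module.finBasis L (FGModuleCat.of L L)
  let M := LinearMap.toMatrix b b (scalar c).hom.hom
  change actionMatrix A α M ≫ (∑ i, tproj A _ i ≫ (α (b i : L) : A ⟶ A)) =
    (∑ i, tproj A _ i ≫ (α (b i : L) : A ⟶ A)) ≫ (α c : A ⟶ A)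
  rw [actionMatrix, Preadditive.sum_comp, Preadditive.sum_comp]
  refine Finset.sum_congr rfl fun i _ => ?_
  have := sum_tproj_comp_sum_tinj (fun j => tproj A _ i ≫ (α (M j i) : A ⟶ A))
    (fun j => (α (b j : L) : A ⟶ A))
  simp only [Category.assoc] at this
  rw [this, ← Preadditive.comp_sum, Category.assoc]
  congr 1
  simp only [action_comp]
  refine (map_sum α (fun j => (b j : L) * M j i) Finset.univ).symm.trans (congrArg α ?_)
  refine Eq.trans (Finset.sum_congr rfl fun j _ => ?_) (b.sum_repr ((scalar c).hom.hom (b i)))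
  rw [show M j i = b.repr ((scalar c).hom.hom (b i)) j from LinearMap.toMatrix_apply ..]
  exact mul_comm _ _

theorem expFunctorIso_app_evalIso {A : HopfBicom k} {α : L →+* End A}
    (G : FGModuleCat.{v} L ⥤ HopfBicom k) [G.Additive] (e : G.obj (FGModuleCat.of L L) ≅ A)
    (he : ∀ c : L, G.map (scalar c) ≫ e.hom = e.hom ≫ (α c : A ⟶ A)) :
    (expFunctorIso G e he).hom.app (FGModuleCat.of L L) ≫ e.hom = (evalIso A α).hom := by
  change (∑ i, tproj A _ i ≫ e.inv ≫ G.map (FGModuleCat.point _ _)) ≫ e.hom = _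
  rw [Preadditive.sum_comp]
  refine Finset.sum_congr rfl fun i _ => ?_
  -- On L, the map determined by a vector is multiplication by that vector, so the equivariance `he`
  -- applies.
  have h : FGModuleCat.point (FGModuleCat.of L L) (Module.finBasis L (FGModuleCat.of L L) i) =
      scalar (Module.finBasis L (FGModuleCat.of L L) i : L) := by
    refine FGModuleCat.hom_ext (LinearMap.ext fun x => ?_)
    exact mul_comm _ _
  rw [h, Category.assoc, Category.assoc, he, e.inv_hom_id_assoc]
  rfl

theorem basisIso_symm_tproj {A : HopfBicom k} (G : FGModuleCat.{v} L ⥤ HopfBicom k) [G.Additive]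
    (e : G.obj (FGModuleCat.of L L) ≅ A) {V : FGModuleCat.{v} L} {n : ℕ}
    (b : Module.Basis (Fin n) L V) (i : Fin n) :
    (basisIso G e b).inv ≫ tproj A n i = G.map (FGModuleCat.coord V b i) ≫ e.hom :=
  sum_tinj_tproj _ i

theorem isZero_expFunctor_obj_iff {A : HopfBicom k} (α : L →+* End A)
    (hA : 1 < Module.rank k A.X) (V : FGModuleCat.{v} L) :
    IsZero ((expFunctor A α).obj V) ↔ IsZero V := by
  refine ⟨fun h => ?_, fun h => (expFunctor A α).map_isZero h⟩
  have := Module.finrank_zero_iff.1 (eq_zero_of_isZero_tpow hA h)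
  refine (IsZero.iff_id_eq_zero V).2 (FGModuleCat.hom_ext (LinearMap.ext fun x => ?_))
  exact Subsingleton.elim (α := V) _ _

end HopfBicom

end

/-! ### The main theorem -/

theorem mainTheorem2 {k : Type u} [Field k] {L : Type v} [Field L]
    (A : HopfBicom k) (α : L →+* End A) :
    -- the induced functor is additive and exact
    (A.expFunctor α).Additive ∧
    PreservesFiniteLimits (A.expFunctor α) ∧ PreservesFiniteColimits (A.expFunctor α) ∧
    (∀ {U V W : FGModuleCat.{v} L} (f : U ⟶ V) (g : V ⟶ W), Mono f → Epi g → IsExactAt f g →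
      Mono ((A.expFunctor α).map f) ∧ Epi ((A.expFunctor α).map g) ∧
        IsExactAt ((A.expFunctor α).map f) ((A.expFunctor α).map g)) ∧
    -- it is an exponential functor: it turns direct sums into tensor products
    (∀ V W : FGModuleCat.{v} L, Function.Bijective (HopfBicom.expMap (A.expFunctor α) V W)) ∧
    (∃ e : (A.expFunctor α).obj (FGModuleCat.of L L) ≅ A,
      -- its value on `L` is `A` with the given action
      (∀ c : L, (A.expFunctor α).map (HopfBicom.scalar c) ≫ e.hom = e.hom ≫ (α c : A ⟶ A)) ∧
      -- its value on `L^n` is `A^{⊗n}`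
      (∀ n : ℕ, ∃ e' : (A.expFunctor α).obj (FGModuleCat.of L (Fin n → L)) ≅ A.tpow n,
        ∀ i : Fin n, (A.expFunctor α).map
          (FGModuleCat.ofHom (LinearMap.proj i : (Fin n → L) →ₗ[L] L)) ≫ e.hom =
            e'.hom ≫ A.tproj n i) ∧
      -- it is determined by the Hopf algebra with its action
      (∀ (G : FGModuleCat.{v} L ⥤ HopfBicom k), G.Additive →
        ∀ e' : G.obj (FGModuleCat.of L L) ≅ A,
          (∀ c : L, G.map (HopfBicom.scalar c) ≫ e'.hom = e'.hom ≫ (α c : A ⟶ A)) →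
          ∃ η : A.expFunctor α ≅ G, η.hom.app (FGModuleCat.of L L) ≫ e'.hom = e.hom)) ∧
    -- homology theories
    (∀ F : HomologyData.{v + 1, v, w} (FGModuleCat.{v} L), F.IsHomologyTheory →
      (F.comp (A.expFunctor α)).IsHomologyTheory ∧
      (1 < Module.rank k A.X → ((F.comp (A.expFunctor α)).IsOrdinary ↔ F.IsOrdinary))) := by
  have := preservesFiniteLimits_of_additive (A.expFunctor α)
  have := preservesFiniteColimits_of_additive (A.expFunctor α)
  refine ⟨inferInstance, inferInstance, inferInstance, ?_, HopfBicom.expMap_bijective _,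
    ⟨HopfBicom.evalIso A α, HopfBicom.scalar_evalIso A α, fun n => ?_, fun G _ e he =>
      ⟨HopfBicom.expFunctorIso G e he, HopfBicom.expFunctorIso_app_evalIso G e he⟩⟩,
    fun F hF => ⟨hF.comp _, fun hA => ?_⟩⟩
  · intro U V W f g _ _ h
    exact ⟨inferInstance, inferInstance, h.map _⟩
  -- The standard basis replaces the chosen one here, since its coordinate functions are the
  -- projections.
  · let b : Module.Basis (Fin n) L (FGModuleCat.of L (Fin n → L)) := Pi.basisFun L (Fin n)
    refine ⟨(HopfBicom.basisIso _ (HopfBicom.evalIso A α) b).symm, fun i => ?_⟩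
    refine Eq.trans ?_ (HopfBicom.basisIso_symm_tproj _ _ b i).symm
    rfl
  · exact forall₂_congr fun q _ => HopfBicom.isZero_expFunctor_obj_iff α hA _
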